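/- For $f:\mathbb Z\to\mathbb R$ let $$\Sigma(f):=0\vee\sup\{n\ge 1:\ \exists\,x_1<\dots<x_{n+1}\text{ in }\mathbb Z\text{ with } f(x_i)f(x_{i+1})<0\text{ for }1\le i\le n\}\in\mathbb N\cup\{\infty\}$$ be its number of zero-crossings, and let $\Delta_d f(x)=f(x+1)-2f(x)+f(x-1)$. Let $\kappa\in L^\infty([0,\infty)\times\mathbb Z)$ and $u_0\in\ell^1(\mathbb Z)$, and let $u:[0,\infty)\times\mathbb Z\to\mathbb R$, bounded on $[0,T]\times\mathbb Z$ for every $T>0$, be a solution of $$\partial_t u(t,y)=\tfrac12\Delta_d u(t,y)-\kappa(t,y)u(t,y)\quad(t>0,\ y\in\mathbb Z),\qquad u(0,y)=u_0(y)\quad(y\in\mathbb Z),$$ in the sense that, for every $y\in\mathbb Z$, the function $u(\cdot,y)$ is absolutely continuous on bounded time intervals and satisfies the differential equation for almost every $t>0$. Then, for all $0\le s\le t$, $$\Sigma(u(t,\cdot))\le\Sigma(u(s,\cdot)).$$ Moreover, if there are integers $a_0<b_0$ with $$\{y:u_0(y)<0\}=\{y\in\mathbb Z:y\le a_0\}\quad\text{and}\quad\{y:u_0(y)>0\}=\{y\in\mathbb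 Z:y\ge b_0\},$$ then for every $t\ge 0$ there are $a_t<b_t$ in $\mathbb Z\cup\{-\infty,\infty\}$ with $$\{y:u(t,y)<0\}=\{y\in\mathbb Z:y\le a_t\}\quad\text{and}\quad\{y:u(t,y)>0\}=\{y\in\mathbb Z:y\ge b_t\}.$$ -/

import Mathlib

open MeasureTheory Set

/-- The number of zero-crossings (sign changes) of `f : ℤ → ℝ`, with values in `ℕ ∪ {∞}`: the
supremum of the `n ≥ 1` for which there are integers `x 0 < ⋯ < x n` with
`f (x i) * f (x (i + 1)) < 0` for all `i < n`, and `0` if there is no such `n`. -/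
noncomputable def zeroCrossings (f : ℤ → ℝ) : ℕ∞ :=
  0 ⊔ sSup {m : ℕ∞ | ∃ n : ℕ, 1 ≤ n ∧ m = (n : ℕ∞) ∧
    ∃ x : Fin (n + 1) → ℤ, StrictMono x ∧ ∀ i : Fin n, f (x i.castSucc) * f (x i.succ) < 0}

/-- The discrete Laplace operator on `ℤ`. -/
def discreteLaplacian (f : ℤ → ℝ) (x : ℤ) : ℝ :=
  f (x + 1) - 2 * f x + f (x - 1)

/-- `u : [0, ∞) × ℤ → ℝ` solves `∂ₜ u = ½ Δ_d u - κ u`, `u (0, ·) = u₀`. As `κ` is only measurable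
in time, this is meant in the sense of Carathéodory: for every site `y`, the function `u (·, y)` is
absolutely continuous on bounded time intervals and satisfies the equation at almost every time.
Values of `κ` and `u` at negative times play no role. -/
structure IsParabolicSolution (κ : ℝ → ℤ → ℝ) (u₀ : ℤ → ℝ) (u : ℝ → ℤ → ℝ) : Prop where
  initial : ∀ y : ℤ, u 0 y = u₀ y
  absolutelyContinuous : ∀ y : ℤ, ∀ T : ℝ, 0 ≤ T →
    AbsolutelyContinuousOnInterval (fun t => u t y) 0 T
  equation : ∀ y : ℤ, ∀ᵐ t ∂(volume.restrict (Ioi (0 : ℝ))),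
    HasDerivAt (fun s => u s y) (1 / 2 * discreteLaplacian (u t) y - κ t y * u t y) t

/-- `f` is negative exactly at the integers `≤ a` and positive exactly at the integers `≥ b`, where
`a < b` belong to `ℤ ∪ {-∞, ∞}`. -/
def HasSignPattern (f : ℤ → ℝ) (a b : WithBot (WithTop ℤ)) : Prop :=
  a < b ∧ {y : ℤ | f y < 0} = {y : ℤ | ((y : WithTop ℤ) : WithBot (WithTop ℤ)) ≤ a} ∧
    {y : ℤ | 0 < f y} = {y : ℤ | b ≤ ((y : WithTop ℤ) : WithBot (WithTop ℤ))}

/-! The solution is a limit of products of simple positive matrices, none of which creates sign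
changes. Over a time step `h`, the evolution agrees up to `O(h ^ 2)`, uniformly in space, with a
positive diagonal matrix times `(1 + q S) (1 + q S⁻¹)`, where `q = h / 2` and `S` is the shift. A
nonzero value of `f x + q * f (x ± 1)` has the sign of one of its two terms, so each factor
transports signs along a monotone map (`splitStep_signDominated`). Consistency and stability give
convergence (`IsParabolicSolution.isSplittingLimit`), and sign changes cannot appear in a pointwise
limit (`zeroCrossings_le_of_tendsto`).

For a single interface, monotonicity of the count leaves open zeros between values of one sign, the
reversed order of signs, and the loss of a sign. The first two are excluded by perturbing the datum
by a small positive mass to the right of the interface: this keeps its sign order but turns a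
nonnegative value into a positive one (`IsSplittingLimit.neg_of_lt`). The third is excluded by
tails: mass travels `j` sites with weight of order `(τ / 2) ^ j / j!`, so far to the right the
positive mass, which starts closer, wins (`IsSplittingLimit.exists_pos`). Reflection gives the other
side. -/

open Filter Topology

/-! ### Sign inheritance along monotone maps -/

/-- `g` inherits its signs from `f` along a monotone map; then `g` has no more sign changes than
`f`. -/
def SignDominated (g f : ℤ → ℝ) : Prop :=
  ∃ z : ℤ → ℤ, Monotone z ∧ ∀ x, g x ≠ 0 → 0 < f (z x) * g x

namespace SignDominated

lemma refl (f : ℤ → ℝ) : SignDominated f f :=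
  ⟨id, monotone_id, fun _ hx => mul_self_pos.2 hx⟩

lemma trans {f g h : ℤ → ℝ} (hhg : SignDominated h g) (hgf : SignDominated g f) :
    SignDominated h f := by
  obtain ⟨z, hz, hzs⟩ := hhg
  obtain ⟨w, hw, hws⟩ := hgf
  refine ⟨w ∘ z, hw.comp hz, fun x hx => ?_⟩
  have h1 := hzs x hx
  have h2 := hws (z x) (left_ne_zero_of_mul h1.ne')
  have h3 : 0 < (f (w (z x)) * h x) * (g (z x)) ^ 2 := by nlinarith [mul_pos h1 h2]
  exact pos_of_mul_pos_left h3 (sq_nonneg _)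

/-- Opposite signs cannot be inherited from one common site, so `z` is strictly increasing across a
crossing. -/
lemma lt_of_mul_neg {f g : ℤ → ℝ} {z : ℤ → ℤ} (hz : Monotone z)
    (hzs : ∀ x, g x ≠ 0 → 0 < f (z x) * g x) {x y : ℤ} (hxy : x < y) (h : g x * g y < 0) :
    z x < z y ∧ f (z x) * f (z y) < 0 := by
  have h1 := hzs x (left_ne_zero_of_mul h.ne)
  have h2 := hzs y (right_ne_zero_of_mul h.ne)
  have h3 : f (z x) * f (z y) < 0 := by
    by_contra hcon
    push Not at hcon
    nlinarith [mul_pos h1 h2, mul_nonneg hcon (neg_nonneg.2 h.le)]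
  refine ⟨lt_of_le_of_ne (hz hxy.le) fun he => ?_, h3⟩
  rw [he] at h3
  nlinarith [mul_self_nonneg (f (z y))]

lemma exists_crossings {f g : ℤ → ℝ} (h : SignDominated g f) {n : ℕ} {x : Fin (n + 1) → ℤ}
    (hx : StrictMono x) (hs : ∀ i : Fin n, g (x i.castSucc) * g (x i.succ) < 0) :
    ∃ x' : Fin (n + 1) → ℤ, StrictMono x' ∧
      ∀ i : Fin n, f (x' i.castSucc) * f (x' i.succ) < 0 := by
  obtain ⟨z, hz, hzs⟩ := h
  have key := fun i : Fin n => lt_of_mul_neg hz hzs (hx i.castSucc_lt_succ) (hs i)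
  exact ⟨z ∘ x, Fin.strictMono_iff_lt_succ.2 fun i => (key i).1, fun i => (key i).2⟩

lemma not_pos_neg {f g : ℤ → ℝ} (h : SignDominated g f)
    (hf : ∀ x y, x < y → 0 < f x → 0 ≤ f y) (x y : ℤ) (hxy : x < y) (hx : 0 < g x) :
    0 ≤ g y := by
  obtain ⟨z, hz, hzs⟩ := h
  by_contra! hy
  have hfx := pos_of_mul_pos_left (hzs x hx.ne') hx.le
  exact absurd (lt_of_mul_neg hz hzs hxy (mul_neg_of_pos_of_neg hx hy)) fun hc =>
    absurd hc.2 (not_lt.2 (mul_nonneg hfx.le (hf _ _ hc.1 hfx)))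

lemma mul_pos {d : ℤ → ℝ} (hd : ∀ x, 0 < d x) (f : ℤ → ℝ) :
    SignDominated (fun x => d x * f x) f :=
  ⟨id, monotone_id, fun x hx => by
    have h := mul_self_pos.2 (right_ne_zero_of_mul hx)
    have := _root_.mul_pos (hd x) h
    simp only [id]; linarith⟩

lemma pos_or_pos {a b q r : ℝ} (hq : 0 ≤ q) (hr : r = a + q * b) (h : r ≠ 0) :
    0 < a * r ∨ 0 < b * r := by
  by_contra! hc
  have : 0 < r * r := mul_self_pos.2 h
  have : r * r = a * r + q * (b * r) := by rw [hr]; ring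
  nlinarith [mul_nonneg hq (neg_nonneg.2 hc.2)]

/-- The source of `x` is `x` or `x + 1`. Any such choice is monotone, since the source of `x` is at
most `x + 1`, and that of `x + 1` at least `x + 1`. -/
lemma add_mul_succ {q : ℝ} (hq : 0 ≤ q) (f : ℤ → ℝ) :
    SignDominated (fun x => f x + q * f (x + 1)) f := by
  classical
  refine ⟨fun x => if 0 < f x * (f x + q * f (x + 1)) then x else x + 1,
    monotone_int_of_le_succ fun x => by split_ifs <;> omega, fun x hx => ?_⟩
  beta_reduce at hx ⊢
  split_ifs with h
  · exact h
  · exact (pos_or_pos hq rfl hx).resolve_left h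

lemma add_mul_pred {q : ℝ} (hq : 0 ≤ q) (f : ℤ → ℝ) :
    SignDominated (fun x => f x + q * f (x - 1)) f := by
  classical
  refine ⟨fun x => if 0 < f x * (f x + q * f (x - 1)) then x else x - 1,
    monotone_int_of_le_succ fun x => by split_ifs <;> omega, fun x hx => ?_⟩
  beta_reduce at hx ⊢
  split_ifs with h
  · exact h
  · exact (pos_or_pos hq rfl hx).resolve_left h

end SignDominated

/-! ### Crossings under pointwise limits -/

lemma natCast_le_zeroCrossings {f : ℤ → ℝ} {n : ℕ} (hn : 1 ≤ n) {x : Fin (n + 1) → ℤ}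
    (hx : StrictMono x) (hs : ∀ i : Fin n, f (x i.castSucc) * f (x i.succ) < 0) :
    (n : ℕ∞) ≤ zeroCrossings f :=
  le_sup_of_le_right (le_sSup ⟨n, hn, rfl, x, hx, hs⟩)

/-- The number of zero-crossings is lower semicontinuous for pointwise convergence. -/
lemma zeroCrossings_le_of_tendsto {f g : ℤ → ℝ} {v : ℕ → ℤ → ℝ}
    (hv : ∀ᶠ N in atTop, SignDominated (v N) f)
    (hlim : ∀ y, Tendsto (fun N => v N y) atTop (𝓝 (g y))) :
    zeroCrossings g ≤ zeroCrossings f := by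
  refine sup_le bot_le (sSup_le ?_)
  rintro _ ⟨n, hn, rfl, x, hx, hs⟩
  -- A given chain of crossings consists of finitely many strict inequalities, an open condition.
  have h1 : ∀ᶠ N in atTop, ∀ i : Fin n, v N (x i.castSucc) * v N (x i.succ) < 0 :=
    eventually_all.2 fun i => ((hlim _).mul (hlim _)).eventually_lt_const (hs i)
  obtain ⟨N, hN1, hN2⟩ := (h1.and hv).exists
  obtain ⟨x', hx', hs'⟩ := hN2.exists_crossings hx hN1
  exact natCast_le_zeroCrossings hn hx' hs'

/-! ### The splitting scheme and its spread estimates -/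

/-- One step of the splitting scheme: a diagonal matrix times
`(1 + q S) (1 + q S⁻¹)`, with `S` the shift. -/
def splitStep (d : ℤ → ℝ) (q : ℝ) (f : ℤ → ℝ) (x : ℤ) : ℝ :=
  d x * ((1 + q ^ 2) * f x + q * (f (x + 1) + f (x - 1)))

/-- Iteration of `splitStep` along a sequence of diagonals. -/
def splitFlow (D : ℕ → ℤ → ℝ) (q : ℝ) (f : ℤ → ℝ) : ℕ → ℤ → ℝ
  | 0 => f
  | k + 1 => splitStep (D k) q (splitFlow D q f k)

/-- The term `q ^ 2` makes the tridiagonal matrix factor into two bidiagonal ones; being of second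
order in the step, it does not harm consistency. -/
lemma splitStep_signDominated {d : ℤ → ℝ} {q : ℝ} (hd : ∀ x, 0 < d x) (hq : 0 ≤ q)
    (f : ℤ → ℝ) : SignDominated (splitStep d q f) f := by
  have h := ((SignDominated.mul_pos hd _).trans
    (SignDominated.add_mul_succ hq (fun x => f x + q * f (x - 1)))).trans
    (SignDominated.add_mul_pred hq f)
  convert h using 2 with x
  simp only [splitStep, add_sub_cancel_right]
  ring

section Flow

variable {D : ℕ → ℤ → ℝ} {q : ℝ}

lemma splitFlow_signDominated (hD : ∀ k x, 0 < D k x) (hq : 0 ≤ q) (f : ℤ → ℝ) (n : ℕ) :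
    SignDominated (splitFlow D q f n) f := by
  induction n with
  | zero => exact .refl f
  | succ k ih => exact (splitStep_signDominated (hD k) hq _).trans ih

lemma splitFlow_add_smul (D : ℕ → ℤ → ℝ) (q c : ℝ) (f g : ℤ → ℝ) (n : ℕ) (x : ℤ) :
    splitFlow D q (fun y => f y + c * g y) n x
      = splitFlow D q f n x + c * splitFlow D q g n x := by
  induction n generalizing x with
  | zero => rfl
  | succ k ih => simp only [splitFlow, splitStep, ih]; ring

lemma splitFlow_nonneg (hD : ∀ k x, 0 < D k x) (hq : 0 ≤ q) {f : ℤ → ℝ} (hf : ∀ y, 0 ≤ f y)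
    (n : ℕ) (x : ℤ) : 0 ≤ splitFlow D q f n x := by
  induction n generalizing x with
  | zero => exact hf x
  | succ k ih =>
    have := hD k x
    have := ih x
    have := ih (x + 1)
    have := ih (x - 1)
    simp only [splitFlow, splitStep]
    positivity

lemma splitFlow_reflect (D : ℕ → ℤ → ℝ) (q : ℝ) (f : ℤ → ℝ) (n : ℕ) (x : ℤ) :
    splitFlow (fun k y => D k (-y)) q (fun y => -f (-y)) n x = -splitFlow D q f n (-x) := by
  induction n generalizing x with
  | zero => rfl
  | succ k ih =>
    simp only [splitFlow, splitStep, ih, show -(x + 1) = -x - 1 by ring,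
      show -(x - 1) = -x + 1 by ring]
    ring

/-- Lower bound for the spread of mass from `b` by `j` sites in the direction `e`. -/
lemma le_splitFlow (hD : ∀ k x, 0 < D k x) {d : ℝ} (hd : 0 ≤ d) (hdD : ∀ k x, d ≤ D k x)
    (hq : 0 ≤ q) {f : ℤ → ℝ} (hf : ∀ y, 0 ≤ f y) {e : ℤ} (he : e = 1 ∨ e = -1) (b : ℤ)
    (n j : ℕ) : d ^ n * (n.choose j * q ^ j) * f b ≤ splitFlow D q f n (b + e * j) := by
  -- Only the mass staying in place and the inflow from one neighbour are kept; Pascal's rule then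
  -- yields the binomial coefficients.
  have step : ∀ k x, d * (splitFlow D q f k x + q * splitFlow D q f k (x - e))
      ≤ splitFlow D q f (k + 1) x := by
    intro k x
    have h0 := splitFlow_nonneg hD hq hf k
    have h1 : splitFlow D q f k x + q * splitFlow D q f k (x - e) ≤
        (1 + q ^ 2) * splitFlow D q f k x
          + q * (splitFlow D q f k (x + 1) + splitFlow D q f k (x - 1)) := by
      have := mul_nonneg (sq_nonneg q) (h0 x)
      have := mul_nonneg hq (h0 (x + 1))
      have := mul_nonneg hq (h0 (x - 1))
      rcases he with rfl | rfl
      · linarith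
      · rw [sub_neg_eq_add]; linarith
    refine (mul_le_mul (hdD k x) h1 ?_ (hD k x).le).trans_eq rfl
    have := h0 x
    have := h0 (x - e)
    positivity
  induction n generalizing j with
  | zero =>
    rcases j with _ | j
    · simp [splitFlow]
    · simpa [splitFlow] using hf _
  | succ k ih =>
    refine le_trans ?_ (step k _)
    rcases j with _ | j
    · have h1 := ih 0
      have h2 := splitFlow_nonneg hD hq hf k (b + e * (0 : ℕ) - e)
      simp only [Nat.choose_zero_right, pow_zero, pow_succ'] at h1 ⊢
      rw [mul_assoc, mul_assoc]
      gcongr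
      nlinarith
    · have h1 := ih (j + 1)
      have h2 := ih j
      rw [show b + e * ((j + 1 : ℕ) : ℤ) - e = b + e * j by push_cast; ring]
      rw [Nat.choose_succ_succ, pow_succ', mul_assoc, mul_assoc]
      refine mul_le_mul_of_nonneg_left ?_ hd
      calc d ^ k * (((k.choose j + k.choose (j + 1) : ℕ) : ℝ) * q ^ (j + 1) * f b)
          = d ^ k * (k.choose (j + 1) * q ^ (j + 1)) * f b
            + q * (d ^ k * (k.choose j * q ^ j) * f b) := by
            push_cast; ring
        _ ≤ _ := by gcongr

lemma splitFlow_le_pow (hD : ∀ k x, 0 < D k x) {d' : ℝ} (hd' : ∀ k x, D k x ≤ d')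
    (hq : 0 ≤ q) {f : ℤ → ℝ} (hf : ∀ y, f y ≤ 1) (n : ℕ) (x : ℤ) :
    splitFlow D q f n x ≤ (d' * ((1 + q) * (1 + q))) ^ n := by
  have hd0 : 0 < d' := (hD 0 0).trans_le (hd' 0 0)
  induction n generalizing x with
  | zero => exact hf x
  | succ k ih =>
    set A := (d' * ((1 + q) * (1 + q))) ^ k with hA
    have hA0 : 0 ≤ A := by positivity
    calc splitFlow D q f (k + 1) x ≤ D k x * ((1 + q ^ 2) * A + q * (A + A)) := by
          have := hD k x
          simp only [splitFlow, splitStep]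
          gcongr <;> apply ih
      _ ≤ d' * ((1 + q ^ 2) * A + q * (A + A)) := by
          gcongr
          exact hd' k x
      _ = _ := by rw [hA, pow_succ]; ring

/-- Upper bound for the spread of a bounded mass on `(-∞, a]` to the right of `a`. -/
lemma splitFlow_le (hD : ∀ k x, 0 < D k x) {d' R : ℝ} (hd' : ∀ k x, D k x ≤ d') (hq : 0 ≤ q)
    {f : ℤ → ℝ} {a : ℤ} (hf1 : ∀ y, f y ≤ 1) (hf0 : ∀ y, a < y → f y ≤ 0) (hR : 1 ≤ R)
    {n : ℕ} (hn : n * q ≤ R) {k : ℕ} (hk : k ≤ n) (x : ℤ) :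
    splitFlow D q f k x ≤ (d' * ((1 + q) * (1 + q * R))) ^ k *
      ((k * q) ^ (x - a).toNat / (x - a).toNat.factorial) := by
  -- Truncation by `toNat` makes `g` equal to `1` on `(-∞, a]` and, as `0 ^ 0 = 1`, makes `g 0` the
  -- indicator of that half-line.
  set g : ℕ → ℤ → ℝ := fun k x => (k * q) ^ (x - a).toNat / (x - a).toNat.factorial with hg
  have g0 : ∀ k x, 0 ≤ g k x := fun k x => by simp only [hg]; positivity
  have g1 : ∀ k x, k ≤ n → g k (x + 1) ≤ R * g k x := by
    intro k x hk
    rcases lt_or_ge x a with h | h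
    · simp only [hg]
      rw [Int.toNat_of_nonpos (by omega), Int.toNat_of_nonpos (by omega)]
      simpa using hR
    · obtain ⟨m, hm⟩ := Int.eq_ofNat_of_zero_le (sub_nonneg.2 h)
      have e1 : (x - a).toNat = m := by omega
      have e2 : (x + 1 - a).toNat = m + 1 := by omega
      have hkq : k * q / (m + 1) ≤ R := by
        have : (k : ℝ) * q ≤ n * q := by gcongr
        refine (div_le_self (by positivity) (by linarith [(Nat.cast_nonneg m : (0:ℝ) ≤ m)])).trans
          (this.trans hn)
      have : g k (x + 1) = (k * q / (m + 1)) * g k x := by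
        simp only [hg, e1, e2, Nat.factorial_succ, Nat.cast_mul, Nat.cast_succ, pow_succ]
        field_simp
      rw [this]
      exact mul_le_mul_of_nonneg_right hkq (g0 k x)
  -- The factor `1 + q` is needed only for `x ≤ a`, where `g` is constant. To the right of `a`,
  -- Bernoulli's inequality absorbs the inflow into the passage from `k` to `k + 1`.
  have g2 : ∀ k x, g k x + q * g k (x - 1) ≤ (1 + q) * g (k + 1) x := by
    intro k x
    rcases le_or_gt x a with h | h
    · simp only [hg]
      rw [Int.toNat_of_nonpos (by omega), Int.toNat_of_nonpos (by omega)]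
      simp
    · obtain ⟨m, hm⟩ := Int.eq_ofNat_of_zero_le (show 0 ≤ x - a - 1 by omega)
      have e1 : (x - a).toNat = m + 1 := by omega
      have e2 : (x - 1 - a).toNat = m := by omega
      have hle : g k x + q * g k (x - 1) ≤ g (k + 1) x := by
        have hb : (k * q) ^ (m + 1) + q * (m + 1) * (k * q) ^ m ≤ ((k + 1) * q) ^ (m + 1) := by
          have h0 : (0:ℝ) ≤ k * q := by positivity
          have := pow_add_mul_le_add_pow (a := k * q) (b := q) h0 (by linarith) (m + 1)
          rw [Nat.add_sub_cancel, Nat.cast_succ] at this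
          rw [add_one_mul]
          linarith
        have : g k x + q * g k (x - 1)
            = ((k * q) ^ (m + 1) + q * (m + 1) * (k * q) ^ m) / (m + 1).factorial := by
          simp only [hg, e1, e2, Nat.factorial_succ, Nat.cast_mul, Nat.cast_succ]
          field_simp
        rw [this]
        simp only [hg, e1, Nat.cast_succ]
        gcongr
      have := mul_nonneg hq (g0 (k + 1) x)
      linarith
  change _ ≤ _ * g k x
  have hd0 : 0 < d' := (hD 0 0).trans_le (hd' 0 0)
  induction k generalizing x with
  | zero =>
    simp only [splitFlow, pow_zero, one_mul]
    rcases le_or_gt x a with h | h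
    · simpa [hg, Int.toNat_of_nonpos (show x - a ≤ 0 by omega)] using hf1 x
    · exact (hf0 x h).trans (g0 _ _)
  | succ k ih =>
    have ih' := ih (by omega)
    set A := (d' * ((1 + q) * (1 + q * R))) ^ k with hA
    have hA0 : 0 ≤ A := by positivity
    have hx := g0 k x
    have hx1 := g0 k (x + 1)
    have hxm := g0 k (x - 1)
    have h1 := g1 k x (by omega)
    have h2 := g1 k (x - 1) (by omega)
    rw [sub_add_cancel] at h2
    calc splitFlow D q f (k + 1) x
        ≤ D k x * ((1 + q ^ 2) * (A * g k x) + q * (A * g k (x + 1) + A * g k (x - 1))) := by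
          have := hD k x
          simp only [splitFlow, splitStep]
          gcongr <;> apply ih'
      _ ≤ d' * ((1 + q ^ 2) * (A * g k x) + q * (A * g k (x + 1) + A * g k (x - 1))) := by
          gcongr
          exact hd' k x
      _ = d' * A * ((g k x + q * g k (x - 1)) + q * (g k (x + 1) + q * g k x)) := by ring
      _ ≤ d' * A * ((1 + q * R) * (g k x + q * g k (x - 1))) := by
          gcongr
          nlinarith [mul_le_mul_of_nonneg_left h1 hq,
            mul_le_mul_of_nonneg_left h2 (mul_nonneg hq hq)]
      _ ≤ d' * A * ((1 + q * R) * ((1 + q) * g (k + 1) x)) := by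
          gcongr
          exact g2 k x
      _ = _ := by rw [hA, pow_succ]; ring

end Flow

/-! ### Bounds on the potential and local consistency -/

/-- Every site has positive counting measure, so a null set of the product has a null section at
each site, and one essential bound serves all sites. -/
lemma exists_ae_bound_of_memLp_top {κ : ℝ → ℤ → ℝ}
    (hκ : MemLp (fun p : ℝ × ℤ => κ p.1 p.2) ⊤
      ((volume.restrict (Ici (0 : ℝ))).prod (Measure.count : Measure ℤ))) :
    ∃ K : ℝ, 0 ≤ K ∧ ∀ y : ℤ,
      AEStronglyMeasurable (fun t => κ t y) (volume.restrict (Ici (0 : ℝ))) ∧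
      ∀ᵐ t ∂(volume.restrict (Ici (0 : ℝ))), |κ t y| ≤ K := by
  have hq : ∀ y : ℤ, Measure.QuasiMeasurePreserving (fun t : ℝ => (t, y))
      (volume.restrict (Ici (0 : ℝ)))
      ((volume.restrict (Ici (0 : ℝ))).prod (Measure.count : Measure ℤ)) := by
    intro y
    refine ⟨measurable_prodMk_right, Measure.AbsolutelyContinuous.mk fun s hs h0 => ?_⟩
    rw [Measure.map_apply measurable_prodMk_right hs]
    rw [Measure.prod_apply_symm hs, lintegral_eq_zero_iff (measurable_measure_prodMk_right hs),
      Filter.EventuallyEq, Measure.ae_count_iff] at h0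
    exact h0 y
  refine ⟨(eLpNorm (fun p : ℝ × ℤ => κ p.1 p.2) ⊤ ((volume.restrict (Ici (0 : ℝ))).prod
    (Measure.count : Measure ℤ))).toReal, ENNReal.toReal_nonneg, fun y => ⟨?_, ?_⟩⟩
  · exact hκ.1.comp_quasiMeasurePreserving (hq y)
  · refine (hq y).ae (p := fun p : ℝ × ℤ => |κ p.1 p.2| ≤ _) ?_
    have := ae_le_eLpNormEssSup (f := fun p : ℝ × ℤ => κ p.1 p.2)
      (μ := (volume.restrict (Ici (0 : ℝ))).prod (Measure.count : Measure ℤ))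
    filter_upwards [this] with p hp
    rw [← eLpNorm_exponent_top, ← ofReal_norm,
      ENNReal.ofReal_le_iff_le_toReal hκ.2.ne] at hp
    exact hp

section Consistency

variable {κ : ℝ → ℤ → ℝ} {u₀ : ℤ → ℝ} {u : ℝ → ℤ → ℝ} {K C T a b : ℝ}

lemma intervalIntegrable_potential
    (hm : ∀ y : ℤ, AEStronglyMeasurable (fun t => κ t y) (volume.restrict (Ici (0 : ℝ))))
    (hκ : ∀ y : ℤ, ∀ᵐ t ∂(volume.restrict (Ici (0 : ℝ))), |κ t y| ≤ K)
    (ha : 0 ≤ a) (hab : a ≤ b) (y : ℤ) :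
    IntervalIntegrable (fun t => κ t y) volume a b := by
  have hsub : Ioc a b ⊆ Ici 0 := fun t ht => ha.trans ht.1.le
  rw [intervalIntegrable_iff_integrableOn_Ioc_of_le hab]
  exact IntegrableOn.of_bound measure_Ioc_lt_top ((hm y).mono_set hsub) K
    (ae_restrict_of_ae_restrict_of_subset hsub (hκ y))

lemma abs_integral_potential_le
    (hκ : ∀ y : ℤ, ∀ᵐ t ∂(volume.restrict (Ici (0 : ℝ))), |κ t y| ≤ K)
    (ha : 0 ≤ a) (hab : a ≤ b) (y : ℤ) : |∫ t in a..b, κ t y| ≤ K * (b - a) := by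
  have := intervalIntegral.norm_integral_le_of_norm_le_const_ae (f := fun t => κ t y)
    (a := a) (b := b) (C := K) ?_
  · rwa [abs_of_nonneg (sub_nonneg.2 hab)] at this
  · filter_upwards [(ae_restrict_iff' measurableSet_Ici).1 (hκ y)] with t ht hab'
    rw [uIoc_of_le hab] at hab'
    exact ht (ha.trans hab'.1.le)

namespace IsParabolicSolution

lemma ae_deriv_eq (hu : IsParabolicSolution κ u₀ u) (ha : 0 ≤ a) (hab : a ≤ b) (y : ℤ) :
    ∀ᵐ t, t ∈ uIoc a b → deriv (fun s => u s y) t =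
      1 / 2 * discreteLaplacian (u t) y - κ t y * u t y := by
  filter_upwards [(ae_restrict_iff' measurableSet_Ioi).1 (hu.equation y)] with t ht hab'
  rw [uIoc_of_le hab] at hab'
  exact (ht (ha.trans_lt hab'.1)).deriv

lemma absolutelyContinuousOnInterval (hu : IsParabolicSolution κ u₀ u) (ha : 0 ≤ a)
    (hab : a ≤ b) (y : ℤ) : AbsolutelyContinuousOnInterval (fun t => u t y) a b := by
  refine (hu.absolutelyContinuous y b (ha.trans hab)).mono ?_
  rw [uIcc_of_le hab, uIcc_of_le (ha.trans hab)]
  exact Icc_subset_Icc_left ha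

lemma intervalIntegrable (hu : IsParabolicSolution κ u₀ u) (ha : 0 ≤ a) (hab : a ≤ b) (y : ℤ) :
    IntervalIntegrable (fun t => 1 / 2 * discreteLaplacian (u t) y - κ t y * u t y)
      volume a b :=
  (hu.absolutelyContinuousOnInterval ha hab y).intervalIntegrable_deriv.congr_ae
    ((ae_restrict_iff' measurableSet_uIoc).2 (hu.ae_deriv_eq ha hab y))

lemma integral_eq_sub (hu : IsParabolicSolution κ u₀ u) (ha : 0 ≤ a) (hab : a ≤ b) (y : ℤ) :
    ∫ t in a..b, (1 / 2 * discreteLaplacian (u t) y - κ t y * u t y) = u b y - u a y := by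
  rw [← (hu.absolutelyContinuousOnInterval ha hab y).integral_deriv_eq_sub]
  exact (intervalIntegral.integral_congr_ae (hu.ae_deriv_eq ha hab y)).symm

lemma abs_generator_le {f : ℤ → ℝ} {c k : ℝ} {y : ℤ} (hf : ∀ y, |f y| ≤ c) (hk : |k| ≤ K) :
    |1 / 2 * discreteLaplacian f y - k * f y| ≤ (2 + K) * c := by
  have h1 := abs_le.1 (hf (y + 1))
  have h2 := abs_le.1 (hf y)
  have h3 := abs_le.1 (hf (y - 1))
  have h4 : |k * f y| ≤ K * c := by
    rw [abs_mul]
    exact mul_le_mul hk (hf y) (abs_nonneg _) ((abs_nonneg _).trans hk)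
  have h5 := abs_le.1 h4
  unfold discreteLaplacian
  rw [abs_le]
  constructor <;> linarith

lemma abs_sub_le (hu : IsParabolicSolution κ u₀ u)
    (hκ : ∀ y : ℤ, ∀ᵐ t ∂(volume.restrict (Ici (0 : ℝ))), |κ t y| ≤ K)
    (hC : ∀ t ∈ Icc (0 : ℝ) T, ∀ y : ℤ, |u t y| ≤ C)
    (ha : 0 ≤ a) (hab : a ≤ b) (hbT : b ≤ T) (y : ℤ) :
    |u b y - u a y| ≤ (2 + K) * C * (b - a) := by
  rw [← hu.integral_eq_sub ha hab y]
  have := intervalIntegral.norm_integral_le_of_norm_le_const_ae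
    (f := fun t => 1 / 2 * discreteLaplacian (u t) y - κ t y * u t y)
    (a := a) (b := b) (C := (2 + K) * C) ?_
  · rwa [abs_of_nonneg (sub_nonneg.2 hab)] at this
  · filter_upwards [(ae_restrict_iff' measurableSet_Ici).1 (hκ y)] with t ht hab'
    rw [uIoc_of_le hab] at hab'
    have h0 : 0 ≤ t := ha.trans hab'.1.le
    exact abs_generator_le (hC t ⟨h0, hab'.2.trans hbT⟩) (ht h0)

/-- The local error of the splitting scheme is quadratic in the step size. -/
lemma abs_sub_splitStep_le (hu : IsParabolicSolution κ u₀ u)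
    (hm : ∀ y : ℤ, AEStronglyMeasurable (fun t => κ t y) (volume.restrict (Ici (0 : ℝ))))
    (hK : 0 ≤ K) (hκ : ∀ y : ℤ, ∀ᵐ t ∂(volume.restrict (Ici (0 : ℝ))), |κ t y| ≤ K)
    (hC : ∀ t ∈ Icc (0 : ℝ) T, ∀ y : ℤ, |u t y| ≤ C)
    (ha : 0 ≤ a) (hab : a ≤ b) (hbT : b ≤ T) (h1 : b - a ≤ 1) (y : ℤ) :
    |u b y - splitStep (fun y => 1 - (b - a) - ∫ t in a..b, κ t y) ((b - a) / 2) (u a) y|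
      ≤ C * ((2 + K) ^ 2 + 2 * (2 + K)) * (b - a) ^ 2 := by
  have hI := intervalIntegrable_potential hm hκ ha hab y
  have hk := abs_integral_potential_le hκ ha hab y
  have hC0 : 0 ≤ C := (abs_nonneg _).trans (hC a ⟨ha, hab.trans hbT⟩ y)
  have h0 : 0 ≤ b - a := sub_nonneg.2 hab
  have hua := hC a ⟨ha, hab.trans hbT⟩
  -- Freezing `u` at time `a` in the integrated equation: the generator, of norm at most `2 + K`,
  -- acts on an increment of size `(2 + K) * C * (b - a)`.
  have e1 : |u b y - u a y - ((b - a) * (1 / 2 * discreteLaplacian (u a) y)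
      - (∫ t in a..b, κ t y) * u a y)| ≤ (2 + K) * ((2 + K) * C * (b - a)) * (b - a) := by
    have hc : IntervalIntegrable (fun t => 1 / 2 * discreteLaplacian (u a) y - κ t y * u a y)
        volume a b := intervalIntegrable_const.sub (hI.mul_const _)
    have : (b - a) * (1 / 2 * discreteLaplacian (u a) y) - (∫ t in a..b, κ t y) * u a y
        = ∫ t in a..b, (1 / 2 * discreteLaplacian (u a) y - κ t y * u a y) := by
      rw [intervalIntegral.integral_sub intervalIntegrable_const (hI.mul_const _),
        intervalIntegral.integral_const, intervalIntegral.integral_mul_const, smul_eq_mul]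
    rw [this, ← hu.integral_eq_sub ha hab y,
      ← intervalIntegral.integral_sub (hu.intervalIntegrable ha hab y) hc]
    have := intervalIntegral.norm_integral_le_of_norm_le_const_ae
      (f := fun t => (1 / 2 * discreteLaplacian (u t) y - κ t y * u t y)
        - (1 / 2 * discreteLaplacian (u a) y - κ t y * u a y))
      (a := a) (b := b) (C := (2 + K) * ((2 + K) * C * (b - a))) ?_
    · rwa [abs_of_nonneg h0] at this
    · filter_upwards [(ae_restrict_iff' measurableSet_Ici).1 (hκ y)] with t ht hab'
      rw [uIoc_of_le hab] at hab'
      have hg := abs_generator_le (f := fun y => u t y - u a y) (y := y)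
        (c := (2 + K) * C * (b - a)) (fun y =>
          (hu.abs_sub_le hκ hC ha hab'.1.le (hab'.2.trans hbT) y).trans (by
            have := hab'.2
            gcongr)) (ht (ha.trans hab'.1.le))
      refine le_of_eq_of_le ?_ hg
      simp only [discreteLaplacian, Real.norm_eq_abs]
      congr 1
      ring
  set k := ∫ t in a..b, κ t y with hkdef
  set h := b - a with hh
  have e2 : |(h / 2) ^ 2 * u a y| ≤ C / 4 * h ^ 2 := by
    rw [abs_mul, abs_of_nonneg (sq_nonneg _)]
    nlinarith [hua y, sq_nonneg h]
  have e3 : |(h + k) * ((h / 2) ^ 2 * u a y + h / 2 * (u a (y + 1) + u a (y - 1)))|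
      ≤ (1 + K) * h * (5 / 4 * C * h) := by
    rw [abs_mul]
    refine mul_le_mul ?_ ?_ (abs_nonneg _) (by positivity)
    · refine (abs_add_le _ _).trans ?_
      rw [abs_of_nonneg h0]
      linarith
    · refine (abs_add_le _ _).trans ?_
      have h4 : |h / 2 * (u a (y + 1) + u a (y - 1))| ≤ h / 2 * (C + C) := by
        rw [abs_mul, abs_of_nonneg (by positivity)]
        gcongr
        exact (abs_add_le _ _).trans (add_le_add (hua _) (hua _))
      have : C / 4 * h ^ 2 ≤ C / 4 * h := by
        gcongr
        nlinarith
      linarith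
  -- The part `1 - h` of the diagonal supplies the `-2 * f x` of the Laplacian. What remains are the
  -- `q ^ 2` term and the product of `h + k` with the terms of order `h`.
  have key : u b y - splitStep (fun y => 1 - h - ∫ t in a..b, κ t y) (h / 2) (u a) y
      = (u b y - u a y - (h * (1 / 2 * discreteLaplacian (u a) y) - k * u a y))
        - (h / 2) ^ 2 * u a y
        + (h + k) * ((h / 2) ^ 2 * u a y + h / 2 * (u a (y + 1) + u a (y - 1))) := by
    simp only [splitStep, discreteLaplacian, ← hkdef]
    ring
  rw [key]
  refine (abs_add_le _ _).trans ((add_le_add (abs_sub _ _) e3).trans ?_)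
  refine (add_le_add (add_le_add e1 e2) le_rfl).trans ?_
  have : 0 ≤ C * h ^ 2 := by positivity
  nlinarith [mul_nonneg this hK]

end IsParabolicSolution

end Consistency

/-! ### Stability and convergence of the scheme -/

lemma splitStep_abs_sub_le {d : ℤ → ℝ} {q d' e : ℝ} {f g : ℤ → ℝ} (hd : ∀ x, 0 ≤ d x)
    (hd' : ∀ x, d x ≤ d') (hq : 0 ≤ q) (hfg : ∀ x, |f x - g x| ≤ e) (x : ℤ) :
    |splitStep d q f x - splitStep d q g x| ≤ d' * (1 + q) ^ 2 * e := by
  have e0 : 0 ≤ e := (abs_nonneg _).trans (hfg x)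
  have : splitStep d q f x - splitStep d q g x = d x * ((1 + q ^ 2) * (f x - g x)
      + q * ((f (x + 1) - g (x + 1)) + (f (x - 1) - g (x - 1)))) := by
    simp only [splitStep]; ring
  rw [this, abs_mul, abs_of_nonneg (hd x)]
  have h2 : |(1 + q ^ 2) * (f x - g x)
      + q * ((f (x + 1) - g (x + 1)) + (f (x - 1) - g (x - 1)))| ≤ (1 + q) ^ 2 * e := by
    refine (abs_add_le _ _).trans ?_
    rw [abs_mul, abs_mul, abs_of_nonneg hq, abs_of_nonneg (by positivity : 0 ≤ 1 + q ^ 2)]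
    have h3 := (abs_add_le (f (x + 1) - g (x + 1)) (f (x - 1) - g (x - 1))).trans
      (add_le_add (hfg _) (hfg _))
    nlinarith [mul_le_mul_of_nonneg_left h3 hq,
      mul_le_mul_of_nonneg_left (hfg x) (by positivity : 0 ≤ 1 + q ^ 2)]
  rw [mul_assoc]
  exact mul_le_mul (hd' x) h2 (abs_nonneg _) ((hd x).trans (hd' x))

lemma splitting_factor_le {K h R : ℝ} (h0 : 0 ≤ h) (hR : 0 ≤ R) :
    (1 + K * h) * ((1 + h / 2) * (1 + h / 2 * R)) ≤ Real.exp ((K + 1 / 2 + R / 2) * h) := by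
  have e1 := Real.add_one_le_exp (K * h)
  have e2 := Real.add_one_le_exp (h / 2)
  have e3 := Real.add_one_le_exp (h / 2 * R)
  calc (1 + K * h) * ((1 + h / 2) * (1 + h / 2 * R))
      ≤ Real.exp (K * h) * (Real.exp (h / 2) * Real.exp (h / 2 * R)) := by
        gcongr <;> linarith
    _ = _ := by rw [← Real.exp_add, ← Real.exp_add]; congr 1; ring

/-- `g` is the limit of splitting schemes started from `f` over a time span `τ`, for a potential
bounded by `K`. -/
def IsSplittingLimit (K τ : ℝ) (f g : ℤ → ℝ) : Prop :=
  ∃ D : ℕ → ℕ → ℤ → ℝ,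
    (∀ᶠ N : ℕ in atTop, ∀ k y, 1 - (1 + K) * (τ / N) ≤ D N k y ∧ D N k y ≤ 1 + K * (τ / N)) ∧
    ∀ y, Tendsto (fun N : ℕ => splitFlow (D N) (τ / N / 2) f N y) atTop (𝓝 (g y))

lemma tendsto_const_div_natCast (c : ℝ) : Tendsto (fun N : ℕ => c / N) atTop (𝓝 0) :=
  tendsto_const_nhds.div_atTop tendsto_natCast_atTop_atTop

theorem IsParabolicSolution.isSplittingLimit {κ : ℝ → ℤ → ℝ} {u₀ : ℤ → ℝ} {u : ℝ → ℤ → ℝ}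
    {K s t : ℝ} (hu : IsParabolicSolution κ u₀ u)
    (hbdd : ∀ T : ℝ, ∃ C : ℝ, ∀ t ∈ Icc (0 : ℝ) T, ∀ y : ℤ, |u t y| ≤ C)
    (hm : ∀ y : ℤ, AEStronglyMeasurable (fun t => κ t y) (volume.restrict (Ici (0 : ℝ))))
    (hK : 0 ≤ K) (hκ : ∀ y : ℤ, ∀ᵐ t ∂(volume.restrict (Ici (0 : ℝ))), |κ t y| ≤ K)
    (hs : 0 ≤ s) (hst : s ≤ t) : IsSplittingLimit K (t - s) (u s) (u t) := by
  obtain ⟨C, hC⟩ := hbdd t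
  have hτ : 0 ≤ t - s := sub_nonneg.2 hst
  set τ := t - s with hτdef
  set D : ℕ → ℕ → ℤ → ℝ := fun N k y =>
    1 - τ / N - ∫ r in (s + k * (τ / N))..(s + (k + 1) * (τ / N)), κ r y with hDdef
  have hDb : ∀ N k y, 1 - (1 + K) * (τ / N) ≤ D N k y ∧ D N k y ≤ 1 + K * (τ / N) := by
    intro N k y
    have h0 : 0 ≤ τ / N := by positivity
    have := abs_le.1 (abs_integral_potential_le hκ (a := s + k * (τ / N))
      (b := s + (k + 1) * (τ / N)) (by positivity) (by linarith) y)
    simp only [hDdef]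
    constructor <;> linarith [this.1, this.2]
  refine ⟨D, .of_forall hDb, fun y => ?_⟩
  set M := C * ((2 + K) ^ 2 + 2 * (2 + K)) with hM
  have hC0 : 0 ≤ C := (abs_nonneg _).trans (hC s ⟨hs, hst⟩ 0)
  have hM0 : 0 ≤ M := by positivity
  have herr : ∀ᶠ N : ℕ in atTop, ‖splitFlow (D N) (τ / N / 2) (u s) N y - u t y‖
      ≤ (M * τ ^ 2 * Real.exp ((1 + K) * τ)) / N := by
    filter_upwards [(tendsto_const_div_natCast τ).eventually_le_const zero_lt_one,
      (tendsto_const_div_natCast ((1 + K) * τ)).eventually_le_const zero_lt_one,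
      eventually_gt_atTop 0] with N hN1 hN2 hN0
    have hNpos : (0 : ℝ) < N := Nat.cast_pos.2 hN0
    set h := τ / N with hh
    have h0 : 0 ≤ h := by positivity
    have hNh : N * h = τ := mul_div_cancel₀ _ hNpos.ne'
    rw [mul_div_assoc, ← hh] at hN2
    have hD0 : ∀ k y, 0 ≤ D N k y := fun k y => le_trans (by linarith) (hDb N k y).1
    have hρ : (1 + K * h) * (1 + h / 2) ^ 2 ≤ Real.exp ((1 + K) * h) := by
      have := splitting_factor_le (K := K) h0 zero_le_one
      rw [mul_one, ← sq] at this
      exact this.trans_eq (by congr 1; ring)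
    have hρ1 : 1 ≤ Real.exp ((1 + K) * h) := Real.one_le_exp (by positivity)
    -- Each step adds a local error `M * h ^ 2` and amplifies earlier ones by at most `exp ((1 + K)
    -- * h)`. For `k = N` the total is of order `N * h ^ 2 = τ ^ 2 / N`.
    have ind : ∀ k ≤ N, ∀ x, |u (s + k * h) x - splitFlow (D N) (h / 2) (u s) k x|
        ≤ k * (M * h ^ 2) * Real.exp ((1 + K) * h) ^ k := by
      intro k
      induction k with
      | zero => intro _ x; simp [splitFlow]
      | succ k ih =>
        intro hk x
        have hkN : ((k + 1 : ℕ) : ℝ) ≤ N := Nat.cast_le.2 hk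
        push_cast at hkN ⊢
        have hle : s + (k + 1) * h ≤ t := by
          have : (k + 1) * h ≤ N * h := by gcongr
          linarith
        have c1 := hu.abs_sub_splitStep_le (a := s + k * h) (b := s + (k + 1) * h) hm hK hκ hC
          (by positivity) (by linarith) hle (by linarith) x
        have c2 := splitStep_abs_sub_le (hD0 k) (fun x => (hDb N k x).2)
          (by positivity : 0 ≤ h / 2) (ih (by omega)) x
        rw [show s + (k + 1) * h - (s + k * h) = h by ring] at c1
        refine (_root_.abs_sub_le _ _ _).trans ((add_le_add c1 c2).trans ?_)
        have hp : 1 ≤ Real.exp ((1 + K) * h) ^ (k + 1) := one_le_pow₀ hρ1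
        have hMh : 0 ≤ M * h ^ 2 := by positivity
        calc M * h ^ 2 + (1 + K * h) * (1 + h / 2) ^ 2 *
              (k * (M * h ^ 2) * Real.exp ((1 + K) * h) ^ k)
            ≤ M * h ^ 2 * Real.exp ((1 + K) * h) ^ (k + 1) + Real.exp ((1 + K) * h) *
              (k * (M * h ^ 2) * Real.exp ((1 + K) * h) ^ k) := by
              exact add_le_add (le_mul_of_one_le_right hMh hp) (by gcongr)
          _ = _ := by ring
    have := ind N le_rfl y
    rw [hNh, ← Real.exp_nat_mul, show s + τ = t by rw [hτdef]; ring,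
      show (N : ℝ) * ((1 + K) * h) = (1 + K) * τ by rw [← hNh]; ring] at this
    rw [Real.norm_eq_abs, abs_sub_comm]
    refine this.trans_eq ?_
    rw [hh]
    field_simp
  exact tendsto_iff_norm_sub_tendsto_zero.2
    (squeeze_zero' (.of_forall fun _ => norm_nonneg _) herr (tendsto_const_div_natCast _))

/-! ### Signs of splitting limits -/

namespace IsSplittingLimit

variable {K τ : ℝ} {f g : ℤ → ℝ}

/-- Only bounds on the diagonals enter a splitting limit, and these are invariant under reflection.
-/
lemma reflect (h : IsSplittingLimit K τ f g) :
    IsSplittingLimit K τ (fun y => -f (-y)) (fun y => -g (-y)) := by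
  obtain ⟨D, hD, hlim⟩ := h
  refine ⟨fun N k y => D N k (-y), hD.mono fun N hN k y => hN k (-y), fun y => ?_⟩
  simp only [splitFlow_reflect]
  exact (hlim (-y)).neg

lemma eventually_lower_pos (K τ : ℝ) : ∀ᶠ N : ℕ in atTop, 0 < 1 - (1 + K) * (τ / N) := by
  filter_upwards [(tendsto_const_div_natCast ((1 + K) * τ)).eventually_lt_const zero_lt_one]
    with N hN
  rw [mul_div_assoc] at hN
  linarith

lemma zeroCrossings_le (hτ : 0 ≤ τ) (h : IsSplittingLimit K τ f g) :
    zeroCrossings g ≤ zeroCrossings f := by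
  obtain ⟨D, hD, hlim⟩ := h
  refine zeroCrossings_le_of_tendsto ?_ hlim
  filter_upwards [hD, eventually_lower_pos K τ] with N hN hpos
  exact splitFlow_signDominated (fun k x => hpos.trans_le (hN k x).1) (by positivity) f N

/-- This is the Poisson-type limit of the weight in `le_splitFlow`; its positivity makes the lower
bound survive as the step size tends to zero. -/
lemma tendsto_lower (K τ : ℝ) (j : ℕ) :
    Tendsto (fun N : ℕ => (1 - (1 + K) * (τ / N)) ^ N * (N.choose j * (τ / N / 2) ^ j)) atTop
      (𝓝 (Real.exp (-((1 + K) * τ)) * ((τ / 2) ^ j / j.factorial))) := by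
  refine Tendsto.mul ?_ ?_
  · refine (Real.tendsto_one_add_div_pow_exp (-((1 + K) * τ))).congr fun N => ?_
    congr 1
    ring
  · refine ProbabilityTheory.tendsto_choose_mul_pow_atTop j
      (tendsto_const_nhds.congr' ?_)
    filter_upwards [eventually_gt_atTop 0] with N hN
    have : (N : ℝ) ≠ 0 := by positivity
    field_simp

lemma factor_pow_le {R : ℝ} (hK : 0 ≤ K) (hτ : 0 ≤ τ) (hR : 0 ≤ R) {N : ℕ} (hN : 0 < N) :
    ((1 + K * (τ / N)) * ((1 + τ / N / 2) * (1 + τ / N / 2 * R))) ^ N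
      ≤ Real.exp ((K + 1 / 2 + R / 2) * τ) := by
  have hN' : (N : ℝ) ≠ 0 := by positivity
  refine (pow_le_pow_left₀ (by positivity)
    (splitting_factor_le (by positivity : 0 ≤ τ / N) hR) N).trans_eq ?_
  rw [← Real.exp_nat_mul]
  congr 1
  field_simp

/-- If the initial datum is nonpositive up to some site and nonnegative afterwards, and positive
from `b₀` on, the negativity set at a later time is closed downwards. -/
lemma neg_of_lt (hK : 0 ≤ K) (hτ : 0 < τ) (h : IsSplittingLimit K τ f g) {b₀ : ℤ}
    (hneg : ∀ y, y < b₀ → f y ≤ 0) (hpos : ∀ y, b₀ ≤ y → 0 < f y) {x y : ℤ} (hyx : y < x)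
    (hx : g x < 0) : g y < 0 := by
  by_contra! hy
  obtain ⟨D, hD, hlim⟩ := h
  set I : ℤ → ℝ := fun z => if b₀ ≤ z then 1 else 0 with hI
  have hI0 : ∀ z, 0 ≤ I z := fun z => by simp only [hI]; split_ifs <;> norm_num
  have hI1 : ∀ z, I z ≤ 1 := fun z => by simp only [hI]; split_ifs <;> norm_num
  set Γ := Real.exp ((K + 1 / 2 + 1 / 2) * τ) with hΓ
  have hΓ0 : 0 < Γ := Real.exp_pos _
  -- `Γ` bounds the scheme started from `I`, so the perturbation contributes at most `-g x / 2` at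
  -- `x` and the perturbed value there stays negative.
  set ε := -g x / (2 * Γ) with hε
  have hε0 : 0 < ε := div_pos (neg_pos.2 hx) (by positivity)
  -- The site `max b₀ y` carries mass of `I` and lies `j` steps to the right of `y`; what arrives at
  -- `y` makes the perturbed value positive.
  obtain ⟨j, hj⟩ := Int.eq_ofNat_of_zero_le (show 0 ≤ max b₀ y - y by omega)
  have hyj : max b₀ y + (-1) * (j : ℤ) = y := by omega
  have hlow : ∀ᶠ N : ℕ in atTop, 0 < splitFlow (D N) (τ / N / 2) f N y + ε *
      ((1 - (1 + K) * (τ / N)) ^ N * (N.choose j * (τ / N / 2) ^ j)) := by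
    refine ((hlim y).add ((tendsto_lower K τ j).const_mul ε)).eventually_const_lt ?_
    have : 0 < ε * (Real.exp (-((1 + K) * τ)) * ((τ / 2) ^ j / j.factorial)) := by positivity
    linarith
  have hup : ∀ᶠ N : ℕ in atTop, splitFlow (D N) (τ / N / 2) f N x < g x / 2 :=
    (hlim x).eventually_lt_const (by linarith)
  obtain ⟨N, hDN, hd, hl, hu, hN⟩ :=
    (hD.and ((eventually_lower_pos K τ).and (hlow.and (hup.and (eventually_gt_atTop 0))))).exists
  have hD0 : ∀ k x, 0 < D N k x := fun k x => hd.trans_le (hDN k x).1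
  have hq : 0 ≤ τ / N / 2 := by positivity
  have hdom := (splitFlow_signDominated hD0 hq (fun z => f z + ε * I z) N).not_pos_neg ?_ y x
    hyx ?_
  · rw [splitFlow_add_smul] at hdom
    have h1 := splitFlow_le_pow hD0 (fun k x => (hDN k x).2) hq hI1 N x
    have h2 := factor_pow_le hK hτ.le zero_le_one hN
    rw [mul_one] at h2
    have h3 := mul_le_mul_of_nonneg_left (h1.trans h2) hε0.le
    have h4 : ε * Γ = -g x / 2 := by rw [hε]; field_simp
    rw [← hΓ, h4] at h3
    linarith
  · intro z w hzw hz
    by_cases hb : b₀ ≤ z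
    · have := hpos w (by omega)
      have := mul_nonneg hε0.le (hI0 w)
      linarith
    · have := hneg z (by omega)
      simp only [hI, hb, if_false] at hz
      linarith
  · rw [splitFlow_add_smul]
    have h1 := le_splitFlow hD0 hd.le (fun k x => (hDN k x).1) hq hI0 (.inr rfl) (max b₀ y) N j
    rw [hyj, show I (max b₀ y) = 1 from if_pos (le_max_left _ _), mul_one] at h1
    exact hl.trans_le (by gcongr)

/-- A bounded initial datum that is negative only up to `a₀` and positive at some site further right
does not become nonpositive everywhere. -/
lemma exists_pos (hK : 0 ≤ K) (hτ : 0 < τ) (h : IsSplittingLimit K τ f g) {a₀ b₀ : ℤ} {C : ℝ}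
    (hab : a₀ < b₀) (hC : ∀ y, |f y| ≤ C) (hnn : ∀ y, a₀ < y → 0 ≤ f y) (hb : 0 < f b₀) :
    ∃ y, 0 < g y := by
  obtain ⟨D, hD, hlim⟩ := h
  have hC0 : 0 ≤ C := (abs_nonneg _).trans (hC 0)
  set B : ℤ → ℝ := fun z => if z ≤ a₀ then 1 else 0 with hB
  have hB1 : ∀ z, B z ≤ 1 := fun z => by simp only [hB]; split_ifs <;> norm_num
  have hB0 : ∀ z, a₀ < z → B z = 0 := fun z hz => if_neg (by omega)
  have hF : ∀ z, 0 ≤ f z + C * B z := by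
    intro z
    rcases le_or_gt z a₀ with hz | hz
    · simp only [hB, hz, if_true]
      linarith [neg_le_of_abs_le (hC z)]
    · rw [hB0 z hz]
      linarith [hnn z hz]
  obtain ⟨r, hr⟩ := Int.eq_ofNat_of_zero_le (sub_nonneg.2 hab.le)
  have hr1 : 1 ≤ r := by omega
  set A₁ := Real.exp (-((1 + K) * τ)) with hA₁
  set A₂ := Real.exp ((K + 1 / 2 + (1 + τ) / 2) * τ) with hA₂
  have hA₁0 : 0 < A₁ := Real.exp_pos _
  have hA₂0 : 0 < A₂ := Real.exp_pos _
  -- Write `f = (f + C * B) - C * B`. The nonnegative first part is bounded below by its mass at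
  -- `b₀`, which travels `j` sites; the second is bounded above at distance `j + r` from `a₀`. The
  -- choice `R = 1 + τ` satisfies both `1 ≤ R` and `N * q = τ / 2 ≤ R`.
  have hg : ∀ j : ℕ, A₁ * ((τ / 2) ^ j / j.factorial) * f b₀
      - C * (A₂ * ((τ / 2) ^ (j + r) / (j + r).factorial)) ≤ g (b₀ + 1 * j) := by
    intro j
    refine le_of_tendsto_of_tendsto (((tendsto_lower K τ j).mul_const (f b₀)).sub_const _)
      (hlim _) ?_
    filter_upwards [hD, eventually_lower_pos K τ, eventually_gt_atTop 0] with N hDN hd hN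
    have hN' : (N : ℝ) ≠ 0 := by positivity
    have hD0 : ∀ k x, 0 < D N k x := fun k x => hd.trans_le (hDN k x).1
    have hq : 0 ≤ τ / N / 2 := by positivity
    have hNq : N * (τ / N / 2) = τ / 2 := by field_simp
    have h1 := le_splitFlow hD0 hd.le (fun k x => (hDN k x).1) hq hF (.inl rfl) b₀ N j
    rw [splitFlow_add_smul, hB0 b₀ hab, mul_zero, add_zero] at h1
    have h2 := splitFlow_le hD0 (fun k x => (hDN k x).2) hq hB1 (fun z hz => (hB0 z hz).le)
      (by linarith : 1 ≤ 1 + τ) (hNq.trans_le (by linarith)) le_rfl (b₀ + 1 * j)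
    rw [hNq, show (b₀ + 1 * (j : ℤ) - a₀).toNat = j + r by omega] at h2
    have h3 := factor_pow_le hK hτ.le (by linarith : 0 ≤ 1 + τ) hN
    have h4 := mul_le_mul_of_nonneg_left
      (h2.trans (mul_le_mul_of_nonneg_right h3 (by positivity))) hC0
    linarith
  -- As `r ≥ 1`, the ratio of the negative to the positive term is at most a constant over `j + 1`.
  obtain ⟨j, hj⟩ := exists_nat_gt (C * A₂ * (τ / 2) ^ r / (A₁ * f b₀))
  refine ⟨_, lt_of_lt_of_le ?_ (hg j)⟩
  rw [div_lt_iff₀ (by positivity)] at hj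
  have hfac : ((j : ℝ) + 1) * j.factorial ≤ (j + r).factorial := by
    have := Nat.factorial_le (show j + 1 ≤ j + r by omega)
    rw [Nat.factorial_succ] at this
    exact_mod_cast this
  have hlt : C * A₂ * (τ / 2) ^ r < ((j : ℝ) + 1) * (A₁ * f b₀) := by
    have : 0 < A₁ * f b₀ := by positivity
    linarith
  have hj0 : (0 : ℝ) < j.factorial := by positivity
  have e : C * (A₂ * ((τ / 2) ^ (j + r) / (j + r).factorial))
      ≤ C * (A₂ * ((τ / 2) ^ (j + r) / (((j : ℝ) + 1) * j.factorial))) := by gcongr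
  refine sub_pos.2 (e.trans_lt ?_)
  calc C * (A₂ * ((τ / 2) ^ (j + r) / (((j : ℝ) + 1) * j.factorial)))
      = (C * A₂ * (τ / 2) ^ r) / (j + 1) * ((τ / 2) ^ j / j.factorial) := by
        rw [pow_add]
        field_simp
    _ < (A₁ * f b₀) * ((τ / 2) ^ j / j.factorial) := by
        gcongr
        rw [div_lt_iff₀ (by positivity)]
        linarith
    _ = _ := by ring

end IsSplittingLimit

/-! ### The interface -/

/-- A site of each sign bounds the set of the other sign, so both endpoints are integers: the last
negative and the first positive site. -/
lemma exists_hasSignPattern {f : ℤ → ℝ} (hneg : ∀ x y, y < x → f x < 0 → f y < 0)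
    (hpos : ∀ x y, x < y → 0 < f x → 0 < f y) (hn : ∃ y, f y < 0) (hp : ∃ y, 0 < f y) :
    ∃ a b : WithBot (WithTop ℤ), HasSignPattern f a b := by
  obtain ⟨n, hn⟩ := hn
  obtain ⟨p, hp⟩ := hp
  obtain ⟨a, ha, hamax⟩ := Int.exists_greatest_of_bdd (P := fun y => f y < 0)
    ⟨p, fun z hz => not_lt.1 fun hlt => (hpos p z hlt hp).not_gt hz⟩ ⟨n, hn⟩
  obtain ⟨b, hb, hbmin⟩ := Int.exists_least_of_bdd (P := fun y => 0 < f y)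
    ⟨n, fun z hz => not_lt.1 fun hlt => (hneg n z hlt hn).not_gt hz⟩ ⟨p, hp⟩
  refine ⟨((a : WithTop ℤ) : WithBot (WithTop ℤ)), ((b : WithTop ℤ) : WithBot (WithTop ℤ)),
    ?_, ?_, ?_⟩
  · simp only [WithBot.coe_lt_coe, WithTop.coe_lt_coe]
    by_contra! hba
    rcases hba.eq_or_lt with rfl | hlt
    · exact ha.not_gt hb
    · exact ha.not_gt (hpos b a hlt hb)
  · ext y
    simp only [mem_ofPred_eq, WithBot.coe_le_coe, WithTop.coe_le_coe]
    exact ⟨hamax y, fun h => h.eq_or_lt.elim (fun e => e ▸ ha) fun hlt => hneg a y hlt ha⟩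
  · ext y
    simp only [mem_ofPred_eq, WithBot.coe_le_coe, WithTop.coe_le_coe]
    exact ⟨hbmin y, fun h => h.eq_or_lt.elim (fun e => e ▸ hb) fun hlt => hpos b y hlt hb⟩

theorem theorem3p1 (κ : ℝ → ℤ → ℝ) (u₀ : ℤ → ℝ) (u : ℝ → ℤ → ℝ)
    (hκ : MemLp (fun p : ℝ × ℤ => κ p.1 p.2) ⊤
      ((volume.restrict (Ici (0 : ℝ))).prod (Measure.count : Measure ℤ)))
    (hu₀ : Memℓp u₀ 1)
    (hu : IsParabolicSolution κ u₀ u)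
    (hbdd : ∀ T : ℝ, ∃ C : ℝ, ∀ t ∈ Icc (0 : ℝ) T, ∀ y : ℤ, |u t y| ≤ C) :
    (∀ s t : ℝ, 0 ≤ s → s ≤ t → zeroCrossings (u t) ≤ zeroCrossings (u s)) ∧
    (∀ a₀ b₀ : ℤ, a₀ < b₀ → {y : ℤ | u₀ y < 0} = {y : ℤ | y ≤ a₀} →
      {y : ℤ | 0 < u₀ y} = {y : ℤ | b₀ ≤ y} →
      ∀ t : ℝ, 0 ≤ t → ∃ a b : WithBot (WithTop ℤ), HasSignPattern (u t) a b) := by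
  obtain ⟨K, hK, hκK⟩ := exists_ae_bound_of_memLp_top hκ
  have hlim : ∀ {s t : ℝ}, 0 ≤ s → s ≤ t → IsSplittingLimit K (t - s) (u s) (u t) :=
    fun hs hst => hu.isSplittingLimit hbdd (fun y => (hκK y).1) hK (fun y => (hκK y).2) hs hst
  refine ⟨fun s t hs hst => (hlim hs hst).zeroCrossings_le (sub_nonneg.2 hst), ?_⟩
  intro a₀ b₀ hab hneg hpos t ht
  have hneg' : ∀ y, u₀ y < 0 ↔ y ≤ a₀ := fun y => Set.ext_iff.1 hneg y
  have hpos' : ∀ y, 0 < u₀ y ↔ b₀ ≤ y := fun y => Set.ext_iff.1 hpos y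
  have hu0 : u 0 = u₀ := funext hu.initial
  rcases ht.eq_or_lt with rfl | ht
  · rw [hu0]
    refine exists_hasSignPattern (fun x y hyx hx => ?_) (fun x y hxy hx => ?_)
      ⟨a₀, (hneg' _).2 le_rfl⟩ ⟨b₀, (hpos' _).2 le_rfl⟩
    · rw [hneg'] at hx ⊢; omega
    · rw [hpos'] at hx ⊢; omega
  have hl := hlim le_rfl ht.le
  rw [sub_zero, hu0] at hl
  obtain ⟨C, hC⟩ := hbdd 0
  have hC : ∀ y, |u₀ y| ≤ C := fun y => hu0 ▸ hC 0 ⟨le_rfl, le_rfl⟩ y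
  have hle : ∀ y, y < b₀ → u₀ y ≤ 0 := fun y hy =>
    not_lt.1 fun h => absurd ((hpos' y).1 h) (not_le.2 hy)
  have hge : ∀ y, a₀ < y → 0 ≤ u₀ y := fun y hy =>
    not_lt.1 fun h => absurd ((hneg' y).1 h) (not_le.2 hy)
  refine exists_hasSignPattern
    (fun x y => hl.neg_of_lt hK ht hle (fun y => (hpos' y).2)) (fun x y hxy hx => ?_) ?_
    (hl.exists_pos hK ht hab hC hge ((hpos' _).2 le_rfl))
  -- The map `f ↦ -f (-·)` exchanges the two half-lines and keeps the order of signs, so the claims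
  -- on positive values to the right become those on negative values to the left, and conversely.
  · have := hl.reflect.neg_of_lt hK ht (b₀ := -a₀)
      (fun y hy => neg_nonpos.2 (hge _ (by omega)))
      (fun y hy => neg_pos.2 ((hneg' _).2 (by omega)))
      (neg_lt_neg hxy) (by simpa using hx)
    simpa using this
  · obtain ⟨y, hy⟩ := hl.reflect.exists_pos hK ht (a₀ := -b₀) (b₀ := -a₀) (C := C)
      (by omega) (fun y => by simpa using hC (-y))
      (fun y hy => neg_nonneg.2 (hle _ (by omega)))
      (by simpa using (hneg' a₀).2 le_rfl)
    exact ⟨-y, neg_pos.1 hy⟩
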